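/- A partial semigroup is a pair $(S,*)$ where $S$ is a nonempty set and $*$ is an operation defined on a nonempty subset of $S\times S$ such that for all $x,y,z\in S$, if either of $(x*y)*z$ and $x*(y*z)$ is defined, then so is the other and they are equal. Let $\mathbb N=\{1,2,3,\ldots\}$ and let $\mathcal P_f(X)$ be the set of finite nonempty subsets of $X$. For $a\in S$ let $\varphi(a)=\{b\in S: a*b \text{ is defined}\}$, and for $F\in\mathcal P_f(S)$ let $\sigma(F)=\bigcap_{a\in F}\varphi(a)$. $(S,*)$ is adequate if $\sigma(F)\neq\emptyset$ for every $F\in\mathcal P_f(S)$. Let $(S,*)$ be an adequate partial semigroup. Let $\delta S$ be the set of ultrafilters $p$ on $S$ with $\sigma(F)\in p$ for every $F\in\mathcal P_f(S)$; it is a semigroup under the operation given by $A\in p*q$ if and only if $\{x\in S:\{y\in\varphi(x):x*y\in A\}\in q\}\in p$. A sequence $f:\mathbb N\to S$ is adequate if for every $H\in\mathcal P_f(\mathbb N)$ the product $\prod_{t\in H}f(t)$, taken in increasing order of indices, is defined, and for every $F\in\mathcal P_f(S)$ there is $m\in\mathbb N$ such that $\prod_{t\in H}f(t)\in\sigma(F)$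 for every $H\in\mathcal P_f(\mathbb N)$ with $\min H\geq m$. For $k\in\mathbb N$, a set $A\subseteq S$ is a $k$-CR set if for every $L\in\mathcal P_f(S)$ there is $r\in\mathbb N$ such that for every nonempty set $F$ of at most $k$ adequate sequences there are $m\in\mathbb N$, $a\in S^{m+1}$ and $t(1)<\cdots<t(m)\leq r$ in $\mathbb N$ such that for every $f\in F$ the product $a(1)*f(t(1))*a(2)*\cdots*a(m)*f(t(m))*a(m+1)$ is defined and belongs to $A\cap\sigma(L)$. Let $k\text{-}CR(S)$ be the set of all $p\in\delta S$ such that every $A\in p$ is a $k$-CR set. If $S$ is a $1$-CR set in $S$, then $1\text{-}CR(S)$ is nonempty and is a two-sided ideal of $\delta S$, that is, $q*p\in 1\text{-}CR(S)$ and $p*q\in 1\text{-}CR(S)$ for all $p\in 1\text{-}CR(S)$ and $q\in\delta S$. -/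

import Mathlib

/-- A partial semigroup: a set with an operation defined on a nonempty subset of `S × S`
(`op x y = none` means that `x * y` is undefined), such that `(x * y) * z = x * (y * z)` in the
sense that if either side is defined, then so is the other and they are equal. The set `S` is
nonempty by `dom_nonempty`. -/
class PartialSemigroup (S : Type*) where
  op : S → S → Option S
  dom_nonempty : ∃ x y : S, (op x y).isSome
  op_assoc : ∀ x y z : S,
    (op x y).bind (fun u => op u z) = (op y z).bind (fun v => op x v)

namespace PartialSemigroup

variable {S : Type*} [PartialSemigroup S]

/-- `φ(a)`, the set of all `b` for which `a * b` is defined. -/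
def phi (a : S) : Set S := {b | (op a b).isSome}

/-- `σ(F) = ⋂_{a ∈ F} φ(a)`. -/
def sigma (F : Finset S) : Set S := {b | ∀ a ∈ F, b ∈ phi a}

variable (S) in
/-- `S` is adequate if `σ(F)` is nonempty for every finite nonempty `F ⊆ S`. -/
def Adequate : Prop := ∀ F : Finset S, F.Nonempty → (sigma F).Nonempty

/-- `x⁻¹A = {y ∈ φ(x) : x * y ∈ A}`. -/
def leftQuot (x : S) (A : Set S) : Set S := {y | ∃ z, op x y = some z ∧ z ∈ A}

/-- The product of a nonempty list in `S`, in the given order, if it is defined. The factors are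
associated to the left; by associativity this does not matter. -/
def listProd : List S → Option S
  | [] => none
  | a :: l => l.foldlM op a

/-- `∏_{t ∈ H} f(t)`, computed in increasing order of indices, if it is defined. -/
def finProd (f : ℕ+ → S) (H : Finset ℕ+) : Option S :=
  listProd ((H.sort (· ≤ ·)).map f)

/-- Adequate sequences: all finite products are defined, and for each finite nonempty `F ⊆ S` all
finite products of some tail lie in `σ(F)`. -/
def AdequateSeq (f : ℕ+ → S) : Prop :=
  (∀ H : Finset ℕ+, H.Nonempty → (finProd f H).isSome) ∧
  ∀ F : Finset S, F.Nonempty → ∃ m : ℕ+, ∀ H : Finset ℕ+, H.Nonempty → (∀ t ∈ H, m ≤ t) →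
    ∃ x, finProd f H = some x ∧ x ∈ sigma F

/-- `a(1) * f(t(1)) * a(2) * ⋯ * a(m) * f(t(m)) * a(m+1)`, if it is defined. -/
def interleave (f : ℕ+ → S) {m : ℕ} (a : Fin (m + 1) → S) (t : Fin m → ℕ+) : Option S :=
  listProd ((List.ofFn fun i : Fin m => [a i.castSucc, f (t i)]).flatten ++ [a (Fin.last m)])

/-- `A` is a `k`-CR set in `S`. -/
def IsKCR (k : ℕ) (A : Set S) : Prop :=
  ∀ L : Finset S, L.Nonempty → ∃ r : ℕ+,
    ∀ F : Finset (ℕ+ → S), F.Nonempty → F.card ≤ k → (∀ f ∈ F, AdequateSeq f) →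
      ∃ m : ℕ, 0 < m ∧ ∃ (a : Fin (m + 1) → S) (t : Fin m → ℕ+),
        StrictMono t ∧ (∀ i, t i ≤ r) ∧
        ∀ f ∈ F, ∃ x, interleave f a t = some x ∧ x ∈ A ∩ sigma L

variable (S) in
/-- `δS`, the set of ultrafilters on `S` which contain `σ(F)` for every finite nonempty `F`. -/
def Delta : Type _ := {p : Ultrafilter S // ∀ F : Finset S, F.Nonempty → sigma F ∈ p}

theorem leftQuot_mono (x : S) {A B : Set S} (h : A ⊆ B) : leftQuot x A ⊆ leftQuot x B :=
  fun _ ⟨z, hz, hA⟩ => ⟨z, hz, h hA⟩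

theorem leftQuot_inter (x : S) (A B : Set S) :
    leftQuot x (A ∩ B) = leftQuot x A ∩ leftQuot x B := by
  ext y
  constructor
  · rintro ⟨z, hz, hA, hB⟩
    exact ⟨⟨z, hz, hA⟩, ⟨z, hz, hB⟩⟩
  · rintro ⟨⟨z, hz, hA⟩, ⟨w, hw, hB⟩⟩
    obtain rfl : z = w := by simpa [hz] using hw
    exact ⟨z, hz, hA, hB⟩

theorem leftQuot_univ (x : S) : leftQuot x Set.univ = phi x := by
  ext y
  simp [leftQuot, phi, Option.isSome_iff_exists]

theorem phi_mem (q : Delta S) (x : S) : phi x ∈ q.1 := by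
  have h := q.2 {x} (Finset.singleton_nonempty x)
  simpa [sigma] using h

theorem leftQuot_compl_mem (q : Delta S) (x : S) (A : Set S) :
    leftQuot x Aᶜ ∈ q.1 ↔ leftQuot x A ∉ q.1 := by
  constructor
  · intro h h'
    have h2 := Filter.inter_mem h h'
    rw [← leftQuot_inter, Set.compl_inter_self] at h2
    have h3 : leftQuot x (∅ : Set S) = ∅ := by simp [leftQuot]
    rw [h3] at h2
    exact q.1.empty_notMem h2
  · intro h
    have h' := Ultrafilter.compl_mem_iff_notMem.2 h
    refine Filter.mem_of_superset (Filter.inter_mem h' (phi_mem q x)) ?_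
    rintro y ⟨hy, hφ⟩
    obtain ⟨z, hz⟩ := Option.isSome_iff_exists.1 hφ
    exact ⟨z, hz, fun hA => hy ⟨z, hz, hA⟩⟩

/-- The ultrafilter `p * q`, for which `A ∈ p * q` if and only if `{x : x⁻¹A ∈ q} ∈ p`. -/
def Delta.mulUltrafilter (p q : Delta S) : Ultrafilter S :=
  Ultrafilter.ofComplNotMemIff
    { sets := {A | {x | leftQuot x A ∈ q.1} ∈ p.1}
      univ_sets := by
        refine Filter.mem_of_superset Filter.univ_mem fun x _ => ?_
        change leftQuot x Set.univ ∈ q.1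
        rw [leftQuot_univ]
        exact phi_mem q x
      sets_of_superset := fun hA hAB =>
        Filter.mem_of_superset hA fun x hx => Filter.mem_of_superset hx (leftQuot_mono x hAB)
      inter_sets := fun hA hB => by
        refine Filter.mem_of_superset (Filter.inter_mem hA hB) ?_
        rintro x ⟨h1, h2⟩
        change leftQuot x (_ ∩ _) ∈ q.1
        rw [leftQuot_inter]
        exact Filter.inter_mem h1 h2 }
    (fun A => by
      change {x | leftQuot x Aᶜ ∈ q.1} ∉ p.1 ↔ {x | leftQuot x A ∈ q.1} ∈ p.1
      simp only [leftQuot_compl_mem]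
      rw [← Ultrafilter.compl_mem_iff_notMem]
      have : {x | leftQuot x A ∉ q.1}ᶜ = {x | leftQuot x A ∈ q.1} := by ext; simp
      rw [this])

theorem Delta.mem_mulUltrafilter (p q : Delta S) (A : Set S) :
    A ∈ Delta.mulUltrafilter p q ↔ {x | leftQuot x A ∈ q.1} ∈ p.1 := Iff.rfl

theorem Delta.sigma_mem_mul (p q : Delta S) (L : Finset S) (hL : L.Nonempty) :
    sigma L ∈ Delta.mulUltrafilter p q := by
  classical
  rw [Delta.mem_mulUltrafilter]
  refine Filter.mem_of_superset (p.2 L hL) fun x hx => ?_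
  let M : Finset S := L.biUnion fun a => (op a x).toFinset
  have hM : ∀ a ∈ L, ∀ u, op a x = some u → u ∈ M := fun a ha u hu =>
    Finset.mem_biUnion.2 ⟨a, ha, by simp [hu]⟩
  have hMne : M.Nonempty := by
    obtain ⟨a, ha⟩ := hL
    obtain ⟨u, hu⟩ := Option.isSome_iff_exists.1 (hx a ha)
    exact ⟨u, hM a ha u hu⟩
  refine Filter.mem_of_superset (Filter.inter_mem (q.2 M hMne) (phi_mem q x)) ?_
  rintro y ⟨hy, hφ⟩
  obtain ⟨z, hz⟩ := Option.isSome_iff_exists.1 hφ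
  refine ⟨z, hz, fun a ha => ?_⟩
  obtain ⟨u, hu⟩ := Option.isSome_iff_exists.1 (hx a ha)
  have h := op_assoc a x y
  rw [hu, hz] at h
  change (op a z).isSome
  have h' : op u y = op a z := h
  rw [← h']
  exact hy u (hM a ha u hu)

theorem mem_leftQuot_leftQuot (x y z : S) (A : Set S) :
    z ∈ leftQuot y (leftQuot x A) ↔ ∃ u, op x y = some u ∧ z ∈ leftQuot u A := by
  have h := op_assoc x y z
  constructor
  · rintro ⟨v, hv, w, hw, hA⟩
    rw [hv] at h
    have h' : (op x y).bind (fun u => op u z) = some w := h.trans hw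
    obtain ⟨u, hu, hu'⟩ := Option.bind_eq_some_iff.1 h'
    exact ⟨u, hu, w, hu', hA⟩
  · rintro ⟨u, hu, w, hw, hA⟩
    rw [hu] at h
    have h' : (op y z).bind (fun v => op x v) = some w := h.symm.trans hw
    obtain ⟨v, hv, hv'⟩ := Option.bind_eq_some_iff.1 h'
    exact ⟨v, hv, w, hv', hA⟩

/-- The semigroup `(δS, *)`. -/
instance Delta.instSemigroup : Semigroup (Delta S) where
  mul p q := ⟨Delta.mulUltrafilter p q, Delta.sigma_mem_mul p q⟩
  mul_assoc p q r := by
    apply Subtype.ext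
    apply Ultrafilter.ext
    intro A
    change {x | {y | ∃ u, op x y = some u ∧ leftQuot u A ∈ r.1} ∈ q.1} ∈ p.1 ↔
      {x | {y | leftQuot y (leftQuot x A) ∈ r.1} ∈ q.1} ∈ p.1
    have key : ∀ x y : S, (∃ u, op x y = some u ∧ leftQuot u A ∈ r.1) ↔
        leftQuot y (leftQuot x A) ∈ r.1 := by
      intro x y
      constructor
      · rintro ⟨u, hu, hA⟩
        exact Filter.mem_of_superset hA fun z hz =>
          (mem_leftQuot_leftQuot x y z A).2 ⟨u, hu, hz⟩
      · intro h
        obtain ⟨z, hz⟩ := Ultrafilter.nonempty_of_mem h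
        obtain ⟨u, hu, -⟩ := (mem_leftQuot_leftQuot x y z A).1 hz
        refine ⟨u, hu, Filter.mem_of_superset h fun w hw => ?_⟩
        obtain ⟨u', hu', hw'⟩ := (mem_leftQuot_leftQuot x y w A).1 hw
        obtain rfl : u = u' := by simpa [hu] using hu'
        exact hw'
    simp only [key]

variable (S) in
/-- `k`-`CR(S)`, the set of all `p ∈ δS` all of whose members are `k`-CR sets. -/
def kCR (k : ℕ) : Set (Delta S) := {p | ∀ A : Set S, A ∈ p.1 → IsKCR k A}

end PartialSemigroup

/-- A (two-sided) ideal of a semigroup: a nonempty subset closed under multiplication by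
arbitrary elements from either side. -/
def IsSemigroupIdeal {T : Type*} [Semigroup T] (I : Set T) : Prop :=
  I.Nonempty ∧ ∀ p ∈ I, ∀ q : T, q * p ∈ I ∧ p * q ∈ I

namespace PartialSemigroup

variable {S : Type*} [PartialSemigroup S]

/-! For a single sequence, associativity absorbs all but one term into the outer factors: `A` is
1-CR iff for each `L` some `r` forces every adequate `f` to have a term `f t`, `t ≤ r`, with `a * f
t * b ∈ A ∩ σ(L)` (`isKCR_one_iff`). Both ideal laws then follow by moving an extra left or right
factor into `a` or `b`.

Nonemptiness rests on partition regularity (`isKCR_one_or_of_union`). If `A` and `B` are not 1-CR,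
every `σ(M)` contains an `x` dividing nothing in the relevant part of `A` and then a `y` doing the
same for `B`; `x * y` avoids both. Such products, put in front of a tail of an adequate sequence,
refute any bound `r` for `A ∪ B`. Hence the sets with non-1-CR complement form a proper filter, and
any finer ultrafilter will do. -/

theorem foldlM_op_bind (l : List S) (x y : S) :
    ((op x y).bind fun u => l.foldlM op u) = (l.foldlM op y).bind (op x) := by
  induction l generalizing x y with
  | nil => simp
  | cons w l ih =>
    simp only [List.foldlM_cons, Option.bind_eq_bind]
    rw [← Option.bind_assoc, op_assoc, Option.bind_assoc, Option.bind_assoc]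
    exact congrArg _ (funext fun v => ih x v)

theorem listProd_cons (x : S) {l : List S} (hl : l ≠ []) :
    listProd (x :: l) = (listProd l).bind (op x) := by
  cases l with
  | nil => exact absurd rfl hl
  | cons y l => exact foldlM_op_bind l x y

theorem sigma_anti {L M : Finset S} (h : L ⊆ M) : sigma M ⊆ sigma L :=
  fun _ hx a ha => hx a (h ha)

/-! ### Middle factors, and control of `σ` under products -/

/-- The elements `y` for which some product `a * y * b` is defined and lies in `A`. -/
def middleFactors (A : Set S) : Set S :=
  {y | ∃ a b u v, op a y = some u ∧ op u b = some v ∧ v ∈ A}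

theorem op_eq_of_op_eq_left {x y z u v : S} (hu : op x y = some u) (hv : op u z = some v) :
    ∃ w, op y z = some w ∧ op x w = some v := by
  have h := op_assoc x y z
  rw [hu, Option.bind_some, hv] at h
  exact Option.bind_eq_some_iff.1 h.symm

theorem op_eq_of_op_eq_right {x y z w v : S} (hw : op y z = some w) (hv : op x w = some v) :
    ∃ u, op x y = some u ∧ op u z = some v := by
  have h := op_assoc x y z
  rw [hw, Option.bind_some, hv] at h
  exact Option.bind_eq_some_iff.1 h

theorem mem_middleFactors_of_op_left {A : Set S} {x y z : S} (h : op x y = some z)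
    (hz : z ∈ middleFactors A) : x ∈ middleFactors A := by
  obtain ⟨a, b, u, v, hu, hv, hA⟩ := hz
  obtain ⟨c, hc, hcy⟩ := op_eq_of_op_eq_right h hu
  obtain ⟨d, -, hcd⟩ := op_eq_of_op_eq_left hcy hv
  exact ⟨a, d, c, v, hc, hcd, hA⟩

theorem mem_middleFactors_of_op_right {A : Set S} {x y z : S} (h : op x y = some z)
    (hz : z ∈ middleFactors A) : y ∈ middleFactors A := by
  obtain ⟨a, b, u, v, hu, hv, hA⟩ := hz
  obtain ⟨c, -, hcy⟩ := op_eq_of_op_eq_right h hu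
  exact ⟨c, b, u, v, hcy, hv, hA⟩

open Classical in
/-- The element `x` together with all products `a * x` for `a ∈ M`. -/
noncomputable def translates (M : Finset S) (x : S) : Finset S :=
  insert x (M.biUnion fun a => (op a x).toFinset)

theorem self_mem_translates (M : Finset S) (x : S) : x ∈ translates M x := by
  classical exact Finset.mem_insert_self _ _

theorem translates_nonempty (M : Finset S) (x : S) : (translates M x).Nonempty :=
  ⟨x, self_mem_translates M x⟩

theorem mem_translates {M : Finset S} {a x u : S} (ha : a ∈ M) (hu : op a x = some u) :
    u ∈ translates M x := by
  classical exact Finset.mem_insert_of_mem (Finset.mem_biUnion.2 ⟨a, ha, by simp [hu]⟩)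

/-- For `a ∈ M`, `a * (x * y) = (a * x) * y`, and `a * x` is one of the translates. -/
theorem op_mem_sigma {M : Finset S} {x y z : S} (hx : x ∈ sigma M)
    (hy : y ∈ sigma (translates M x)) (hz : op x y = some z) : z ∈ sigma M := by
  intro a ha
  obtain ⟨u, hu⟩ := Option.isSome_iff_exists.1 (hx a ha)
  obtain ⟨v, hv⟩ := Option.isSome_iff_exists.1 (hy u (mem_translates ha hu))
  obtain ⟨w, hw, haw⟩ := op_eq_of_op_eq_left hu hv
  obtain rfl : z = w := by simpa [hz] using hw
  exact Option.isSome_iff_exists.2 ⟨v, haw⟩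

theorem exists_op_mem_sigma {M : Finset S} {x y : S} (hx : x ∈ sigma M)
    (hy : y ∈ sigma (translates M x)) : ∃ z, op x y = some z ∧ z ∈ sigma M := by
  obtain ⟨z, hz⟩ := Option.isSome_iff_exists.1 (hy x (self_mem_translates M x))
  exact ⟨z, hz, op_mem_sigma hx hy hz⟩

theorem mem_middleFactors_of_interleave {A : Set S} {f : ℕ+ → S} {m : ℕ}
    {a : Fin (m + 2) → S} {t : Fin (m + 1) → ℕ+} {x : S} (h : interleave f a t = some x)
    (hx : x ∈ A) : f (t 0) ∈ middleFactors A := by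
  rw [interleave, List.ofFn_succ, List.flatten_cons, List.append_assoc, List.cons_append,
    List.cons_append, List.nil_append, listProd_cons _ (by simp), listProd_cons _ (by simp)] at h
  obtain ⟨w, hw, hx'⟩ := Option.bind_eq_some_iff.1 h
  obtain ⟨b, -, hb⟩ := Option.bind_eq_some_iff.1 hw
  obtain ⟨u, hu, huv⟩ := op_eq_of_op_eq_right hb hx'
  exact ⟨_, b, u, x, hu, huv, hx⟩

/-- For a single sequence it suffices to consider products with three factors. -/
theorem isKCR_one_iff {A : Set S} :
    IsKCR 1 A ↔ ∀ L : Finset S, L.Nonempty → ∃ r : ℕ+, ∀ f : ℕ+ → S, AdequateSeq f →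
      ∃ t ≤ r, f t ∈ middleFactors (A ∩ sigma L) := by
  refine forall₂_congr fun L _ => exists_congr fun r => ⟨fun h f hf => ?_, fun h F hF hc had => ?_⟩
  · obtain ⟨m, hm, a, t, -, htr, hx⟩ := h {f} (Finset.singleton_nonempty f) (by simp) (by simpa)
    obtain ⟨m, rfl⟩ := Nat.exists_eq_succ_of_ne_zero hm.ne'
    obtain ⟨x, hx, hxA⟩ := hx f (by simp)
    exact ⟨t 0, htr 0, mem_middleFactors_of_interleave hx hxA⟩
  · obtain ⟨f, rfl⟩ := Finset.card_eq_one.1 (le_antisymm hc hF.card_pos)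
    obtain ⟨t, htr, a, b, u, v, hu, hv, hvA⟩ := h f (had f (by simp))
    refine ⟨1, one_pos, ![a, b], fun _ => t, Subsingleton.strictMono _, fun _ => htr, ?_⟩
    simp only [Finset.mem_singleton, forall_eq]
    exact ⟨v, by simp [interleave, listProd, hu, hv], hvA⟩

theorem IsKCR.mono {k : ℕ} {A B : Set S} (h : IsKCR k A) (hAB : A ⊆ B) : IsKCR k B := by
  intro L hL
  obtain ⟨r, hr⟩ := h L hL
  refine ⟨r, fun F hF hc had => ?_⟩
  obtain ⟨m, hm, a, t, ht, htr, hx⟩ := hr F hF hc had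
  refine ⟨m, hm, a, t, ht, htr, fun f hf => ?_⟩
  obtain ⟨x, hx, hxA, hxL⟩ := hx f hf
  exact ⟨x, hx, hAB hxA, hxL⟩

/-! ### The two ideal laws -/

theorem mul_mem_kCR_one_left {p : Delta S} (hp : p ∈ kCR S 1) (q : Delta S) :
    q * p ∈ kCR S 1 := by
  intro A hA
  rw [isKCR_one_iff]
  intro L hL
  obtain ⟨x, hxA, hxL⟩ := Ultrafilter.nonempty_of_mem
    (Filter.inter_mem ((Delta.mem_mulUltrafilter q p A).1 hA) (q.2 L hL))
  -- Since `x` is fixed before any sequence is given, `r` may depend on it; the translates ensure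
  -- that multiplying by `x` on the left lands in `σ(L)`.
  obtain ⟨r, hr⟩ := isKCR_one_iff.1 (hp _ hxA) (translates L x) (translates_nonempty L x)
  refine ⟨r, fun f hf => ?_⟩
  obtain ⟨t, htr, a, b, u, v, hu, hv, ⟨z, hz, hzA⟩, hvL⟩ := hr f hf
  obtain ⟨c, hc, hcb⟩ := op_eq_of_op_eq_right hv hz
  obtain ⟨d, hd, hdf⟩ := op_eq_of_op_eq_right hu hc
  exact ⟨t, htr, d, b, c, z, hdf, hcb, hzA, op_mem_sigma hxL hvL hz⟩

theorem mul_mem_kCR_one_right {p : Delta S} (hp : p ∈ kCR S 1) (q : Delta S) :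
    p * q ∈ kCR S 1 := by
  intro A hA
  rw [isKCR_one_iff]
  intro L hL
  obtain ⟨r, hr⟩ := isKCR_one_iff.1 (hp _ ((Delta.mem_mulUltrafilter p q A).1 hA)) L hL
  refine ⟨r, fun f hf => ?_⟩
  obtain ⟨t, htr, a, b, u, w, hu, hw, hwA, hwL⟩ := hr f hf
  -- Here `y` depends on `w`, hence on `f`. This is harmless: it only changes the right factor, not
  -- `r`.
  obtain ⟨y, ⟨z, hz, hzA⟩, hyL⟩ := Ultrafilter.nonempty_of_mem
    (Filter.inter_mem hwA (q.2 (translates L w) (translates_nonempty L w)))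
  obtain ⟨c, -, hc⟩ := op_eq_of_op_eq_left hw hz
  exact ⟨t, htr, a, c, u, z, hu, hc, hzA, op_mem_sigma hwL hyL hz⟩

/-! ### Sequences with prescribed initial terms -/

/-- A set which is not `1`-CR misses, up to multiples, elements from every `σ(M)`. -/
theorem exists_forall_sigma_of_not_isKCR_one (h1 : IsKCR 1 (Set.univ : Set S)) {A : Set S}
    (hA : ¬ IsKCR 1 A) :
    ∃ L : Finset S, L.Nonempty ∧ ∀ M : Finset S, M.Nonempty →
      ∃ z ∈ sigma M, z ∉ middleFactors (A ∩ sigma L) := by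
  rw [isKCR_one_iff] at hA h1
  push Not at hA
  obtain ⟨L, hL, hA⟩ := hA
  refine ⟨L, hL, fun M hM => ?_⟩
  -- The bound for `S` at `M` is fed to the failure of `A`: the first `r` terms of `f` all miss, yet
  -- one of them has a multiple in `σ(M)`, and multiples of a missing element miss too.
  obtain ⟨r, hr⟩ := h1 M hM
  obtain ⟨f, hf, hfA⟩ := hA r
  obtain ⟨t, htr, a, b, u, v, hu, hv, -, hvM⟩ := hr f hf
  exact ⟨v, hvM, fun hv' => hfA t htr
    (mem_middleFactors_of_op_right hu (mem_middleFactors_of_op_left hv hv'))⟩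

/-- Sorted lists split into head and tail, which suits prepending a term to a sequence. -/
theorem forall_finset_finProd_iff {f : ℕ+ → S} {P : Finset ℕ+ → Option S → Prop} :
    (∀ H : Finset ℕ+, H.Nonempty → P H (finProd f H)) ↔
      ∀ l : List ℕ+, l ≠ [] → l.SortedLT → P l.toFinset (listProd (l.map f)) := by
  constructor
  · intro h l hl hs
    have := h l.toFinset (by simpa using hl)
    rwa [finProd, (List.toFinset_sort (· ≤ ·) hs.nodup).2 hs.sortedLE.pairwise] at this
  · intro h H hH
    have := h (H.sort (· ≤ ·)) (fun h0 => hH.ne_empty (by simpa using congrArg List.toFinset h0))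
      (Finset.sortedLT_sort H)
    rwa [Finset.sort_toFinset] at this

theorem adequateSeq_iff {f : ℕ+ → S} :
    AdequateSeq f ↔
      (∀ l : List ℕ+, l ≠ [] → l.SortedLT → (listProd (l.map f)).isSome) ∧
      ∀ F : Finset S, F.Nonempty → ∃ m : ℕ+, ∀ l : List ℕ+, l ≠ [] → l.SortedLT →
        (∀ t ∈ l, m ≤ t) → ∃ x, listProd (l.map f) = some x ∧ x ∈ sigma F := by
  refine and_congr (forall_finset_finProd_iff (P := fun _ o => o.isSome = true))
    (forall₂_congr fun F _ => exists_congr fun m => ?_)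
  simpa using forall_finset_finProd_iff (f := f)
    (P := fun H o => (∀ t ∈ H, m ≤ t) → ∃ x, o = some x ∧ x ∈ sigma F)

/-- The sequence `z, g(1), g(2), …`. -/
def consSeq {α : Type*} (z : α) (g : ℕ+ → α) (n : ℕ+) : α := PNat.recOn n z fun k _ => g k

@[simp] theorem consSeq_one {α : Type*} (z : α) (g : ℕ+ → α) : consSeq z g 1 = z :=
  PNat.recOn_one _ _

@[simp] theorem consSeq_add_one {α : Type*} (z : α) (g : ℕ+ → α) (n : ℕ+) :
    consSeq z g (n + 1) = g n :=
  PNat.recOn_succ _ _ _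

theorem exists_map_add_one {l : List ℕ+} (hs : l.SortedLT) (h : ∀ t ∈ l, 1 < t) :
    ∃ l' : List ℕ+, l'.SortedLT ∧ l = l'.map (· + 1) := by
  have hl : l = (l.map (· - 1)).map (· + 1) := by
    rw [List.map_map]
    conv_lhs => rw [← List.map_id l]
    exact List.map_congr_left fun t ht => (PNat.sub_add_of_lt (h t ht)).symm
  refine ⟨l.map (· - 1), ?_, hl⟩
  have hp := hs.pairwise
  rw [hl, List.pairwise_map] at hp
  exact (hp.imp fun h => by simpa using h).sortedLT

theorem exists_of_sortedLT {l : List ℕ+} (hl : l ≠ []) (hs : l.SortedLT) :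
    ∃ l' : List ℕ+, l'.SortedLT ∧ (l = 1 :: l'.map (· + 1) ∨ l' ≠ [] ∧ l = l'.map (· + 1)) := by
  obtain ⟨a, l, rfl⟩ := List.exists_cons_of_ne_nil hl
  have hp := List.pairwise_cons.1 hs.pairwise
  rcases (one_le (a := a)).eq_or_lt with rfl | ha
  · obtain ⟨l', hs', rfl⟩ := exists_map_add_one hp.2.sortedLT hp.1
    exact ⟨l', hs', Or.inl rfl⟩
  · obtain ⟨l', hs', h⟩ := exists_map_add_one hs (by
      intro t ht
      rcases List.mem_cons.1 ht with rfl | ht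
      · exact ha
      · exact ha.trans (hp.1 t ht))
    refine ⟨l', hs', Or.inr ⟨?_, h⟩⟩
    rintro rfl
    simp at h

/-- All finite products of `f` are defined and lie in `σ(M)`. -/
def ProductsIn (M : Finset S) (f : ℕ+ → S) : Prop :=
  ∀ l : List ℕ+, l ≠ [] → l.SortedLT → ∃ x, listProd (l.map f) = some x ∧ x ∈ sigma M

theorem map_consSeq {α : Type*} (z : α) (g : ℕ+ → α) (l : List ℕ+) :
    (l.map (· + 1)).map (consSeq z g) = l.map g := by
  simp [List.map_map, Function.comp_def]

/-- A product using index 1 is `z` or `z * y` with `y` a product of `g`; any other is a product of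
`g` shifted by one. -/
theorem ProductsIn.consSeq {M : Finset S} {z : S} {g : ℕ+ → S} (hz : z ∈ sigma M)
    (hM : ProductsIn M g) (hg : ProductsIn (translates M z) g) :
    ProductsIn M (consSeq z g) := by
  intro l hl hs
  obtain ⟨l', hs', rfl | ⟨hl', rfl⟩⟩ := exists_of_sortedLT hl hs
  · rw [List.map_cons, map_consSeq, consSeq_one]
    by_cases h0 : l' = []
    · subst h0
      exact ⟨z, rfl, hz⟩
    · obtain ⟨y, hy, hyM⟩ := hg l' h0 hs'
      rw [listProd_cons _ (by simpa using h0), hy]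
      exact exists_op_mem_sigma hz hyM
  · rw [map_consSeq]
    exact hM l' hl' hs'

/-- The tail condition ignores the new first term, at the cost of raising `m` by one. -/
theorem AdequateSeq.consSeq {M : Finset S} {z : S} {g : ℕ+ → S} (hg : AdequateSeq g)
    (h : ProductsIn M (consSeq z g)) : AdequateSeq (consSeq z g) := by
  rw [adequateSeq_iff] at hg ⊢
  refine ⟨fun l hl hs => ?_, fun F hF => ?_⟩
  · obtain ⟨x, hx, -⟩ := h l hl hs
    simp [hx]
  · obtain ⟨m, hm⟩ := hg.2 F hF
    refine ⟨m + 1, fun l hl hs hml => ?_⟩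
    obtain ⟨l', hs', rfl⟩ := exists_map_add_one hs fun t ht =>
      (PNat.lt_add_left 1 m).trans_le (hml t ht)
    rw [map_consSeq]
    exact hm l' (by simpa using hl) hs' fun t ht => by
      simpa using hml (t + 1) (List.mem_map_of_mem ht)

theorem AdequateSeq.exists_productsIn {f : ℕ+ → S} (hf : AdequateSeq f) {M : Finset S}
    (hM : M.Nonempty) : ∃ g : ℕ+ → S, AdequateSeq g ∧ ProductsIn M g := by
  rw [adequateSeq_iff] at hf
  obtain ⟨m, hm⟩ := hf.2 M hM
  have hs' : ∀ {l : List ℕ+}, l.SortedLT → (l.map (· + m)).SortedLT := fun {l} hs =>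
    (List.pairwise_map.2 (hs.pairwise.imp fun h => by simpa using h)).sortedLT
  have hmap : ∀ l : List ℕ+, l.map (fun n => f (n + m)) = (l.map (· + m)).map f := fun l => by
    simp [List.map_map, Function.comp_def]
  refine ⟨fun n => f (n + m), adequateSeq_iff.2 ⟨fun l hl hs => ?_, fun F hF => ?_⟩,
    fun l hl hs => ?_⟩
  · rw [hmap]
    exact hf.1 _ (by simpa using hl) (hs' hs)
  · obtain ⟨k, hk⟩ := hf.2 F hF
    refine ⟨k, fun l hl hs hkl => ?_⟩
    rw [hmap]
    refine hk _ (by simpa using hl) (hs' hs) fun t ht => ?_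
    obtain ⟨n, hn, rfl⟩ := List.mem_map.1 ht
    exact (hkl n hn).trans (PNat.lt_add_right n m).le
  · rw [hmap]
    refine hm _ (by simpa using hl) (hs' hs) fun t ht => ?_
    obtain ⟨n, hn, rfl⟩ := List.mem_map.1 ht
    exact (PNat.lt_add_left m n).le

/-- If `N` meets every `σ(M)`, then some adequate sequence starts with `r` terms in `N`. -/
theorem AdequateSeq.exists_forall_le_mem {f : ℕ+ → S} (hf : AdequateSeq f) {N : Set S}
    (hN : ∀ M : Finset S, M.Nonempty → ∃ z ∈ sigma M, z ∈ N) (r : ℕ) {M : Finset S}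
    (hM : M.Nonempty) :
    ∃ g : ℕ+ → S, AdequateSeq g ∧ ProductsIn M g ∧ ∀ t : ℕ+, (t : ℕ) ≤ r → g t ∈ N := by
  classical
  induction r generalizing M with
  | zero =>
    obtain ⟨g, hg, hgM⟩ := hf.exists_productsIn hM
    exact ⟨g, hg, hgM, fun t ht => absurd t.pos (by omega)⟩
  | succ r ih =>
    obtain ⟨z, hzM, hzN⟩ := hN M hM
    -- Products of `g` must lie in `σ(M)` on their own and in `σ(translates M z)` so that `z` can be
    -- put in front.
    obtain ⟨g, hg, hgM, hgN⟩ := ih (M := M ∪ translates M z) (hM.mono Finset.subset_union_left)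
    have sub : ∀ {L : Finset S}, L ⊆ M ∪ translates M z → ProductsIn L g := fun hL l hl hs =>
      (hgM l hl hs).imp fun _ hx => ⟨hx.1, sigma_anti hL hx.2⟩
    have hcons : ProductsIn M (PartialSemigroup.consSeq z g) :=
      ProductsIn.consSeq hzM (sub Finset.subset_union_left) (sub Finset.subset_union_right)
    refine ⟨_, hg.consSeq hcons, hcons, fun t => ?_⟩
    induction t using PNat.recOn with
    | one => simpa using hzN
    | succ t _ =>
      intro ht
      rw [consSeq_add_one]
      exact hgN t (by simpa using ht)

/-! ### Partition regularity and nonemptiness -/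

theorem isKCR_one_or_of_union (h1 : IsKCR 1 (Set.univ : Set S)) {f : ℕ+ → S}
    (hf : AdequateSeq f) {A B : Set S} (h : IsKCR 1 (A ∪ B)) : IsKCR 1 A ∨ IsKCR 1 B := by
  classical
  by_contra hAB
  rw [not_or] at hAB
  obtain ⟨L, hL, hA⟩ := exists_forall_sigma_of_not_isKCR_one h1 hAB.1
  obtain ⟨K, hK, hB⟩ := exists_forall_sigma_of_not_isKCR_one h1 hAB.2
  have hLK : (L ∪ K).Nonempty := hL.mono Finset.subset_union_left
  obtain ⟨r, hr⟩ := isKCR_one_iff.1 h (L ∪ K) hLK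
  obtain ⟨g, hg, -, hgN⟩ := hf.exists_forall_le_mem
    (N := (middleFactors ((A ∪ B) ∩ sigma (L ∪ K)))ᶜ) (fun M hM => by
      obtain ⟨x, hxM, hxA⟩ := hA M hM
      -- Taking `y` in `σ` of the translates makes `x * y` defined and in `σ(M)`; it inherits the
      -- misses of both factors.
      obtain ⟨y, hyM, hyB⟩ := hB _ (translates_nonempty M x)
      obtain ⟨z, hz, hzM⟩ := exists_op_mem_sigma hxM hyM
      refine ⟨z, hzM, ?_⟩
      rintro ⟨a, b, u, v, hu, hv, hvA | hvB, hvLK⟩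
      · exact hxA (mem_middleFactors_of_op_left hz
          ⟨a, b, u, v, hu, hv, hvA, sigma_anti Finset.subset_union_left hvLK⟩)
      · exact hyB (mem_middleFactors_of_op_right hz
          ⟨a, b, u, v, hu, hv, hvB, sigma_anti Finset.subset_union_right hvLK⟩)) r hLK
  obtain ⟨t, htr, ht⟩ := hr g hg
  exact hgN t htr ht

/-- The set misses its own test set `L`; `f` keeps the condition from being vacuous. This is what
places the ultrafilter in `δS`. -/
theorem not_isKCR_one_compl_sigma {f : ℕ+ → S} (hf : AdequateSeq f) {L : Finset S}
    (hL : L.Nonempty) : ¬ IsKCR 1 (sigma L)ᶜ := by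
  intro h
  obtain ⟨r, hr⟩ := isKCR_one_iff.1 h L hL
  obtain ⟨t, -, a, b, u, v, -, -, hv, hv'⟩ := hr f hf
  exact hv hv'

theorem Delta.nonempty (hS : Adequate S) : Nonempty (Delta S) := by
  classical
  let l : Filter S :=
    { sets := {A | ∃ L : Finset S, L.Nonempty ∧ sigma L ⊆ A}
      univ_sets := by
        obtain ⟨x, _, _⟩ := dom_nonempty (S := S)
        exact ⟨{x}, Finset.singleton_nonempty x, Set.subset_univ _⟩
      sets_of_superset := fun ⟨L, hL, hLA⟩ hAB => ⟨L, hL, hLA.trans hAB⟩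
      inter_sets := fun ⟨L, hL, hLA⟩ ⟨M, _, hMB⟩ =>
        ⟨L ∪ M, hL.mono Finset.subset_union_left, Set.subset_inter
          ((sigma_anti Finset.subset_union_left).trans hLA)
          ((sigma_anti Finset.subset_union_right).trans hMB)⟩ }
  have : l.NeBot := by
    rw [Filter.neBot_iff, ne_eq, ← Filter.empty_mem_iff_bot]
    rintro ⟨L, hL, hL0⟩
    obtain ⟨y, hy⟩ := hS L hL
    exact hL0 hy
  exact ⟨⟨Ultrafilter.of l, fun F hF => Ultrafilter.of_le l ⟨F, hF, subset_rfl⟩⟩⟩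

theorem kCR_one_nonempty (hS : Adequate S) (h1 : IsKCR 1 (Set.univ : Set S)) :
    (kCR S 1).Nonempty := by
  by_cases hf : ∃ f : ℕ+ → S, AdequateSeq f
  · obtain ⟨f, hf⟩ := hf
    let l : Filter S :=
      { sets := {A | ¬ IsKCR 1 Aᶜ}
        univ_sets := fun h => by
          obtain ⟨x, _, _⟩ := dom_nonempty (S := S)
          exact not_isKCR_one_compl_sigma hf (Finset.singleton_nonempty x) (h.mono (by simp))
        sets_of_superset := fun hA hAB h => hA (h.mono (Set.compl_subset_compl.2 hAB))
        inter_sets := fun {A B} hA hB h => by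
          rw [Set.compl_inter] at h
          exact (isKCR_one_or_of_union h1 hf h).elim hA hB }
    have : l.NeBot := by
      rw [Filter.neBot_iff, ne_eq, ← Filter.empty_mem_iff_bot]
      exact fun h => h (by simpa using h1)
    refine ⟨⟨Ultrafilter.of l, fun F hF => Ultrafilter.of_le l (not_isKCR_one_compl_sigma hf hF)⟩,
      fun A hA => ?_⟩
    by_contra hA'
    have hl : Aᶜ ∈ l := fun h => hA' (by simpa using h)
    exact Ultrafilter.compl_mem_iff_notMem.1 (Ultrafilter.of_le l hl) hA
  -- Without adequate sequences every set is vacuously 1-CR, so any point of `δS` works.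
  · obtain ⟨p⟩ := Delta.nonempty hS
    exact ⟨p, fun A _ => isKCR_one_iff.2 fun L _ => ⟨1, fun f hf' => absurd ⟨f, hf'⟩ hf⟩⟩

end PartialSemigroup

theorem corollary3p11 (S : Type*) [PartialSemigroup S] (hS : PartialSemigroup.Adequate S)
    (h1 : PartialSemigroup.IsKCR 1 (Set.univ : Set S)) :
    (PartialSemigroup.kCR S 1).Nonempty ∧ IsSemigroupIdeal (PartialSemigroup.kCR S 1) := by
  have h := PartialSemigroup.kCR_one_nonempty hS h1
  exact ⟨h, h, fun _ hp q => ⟨PartialSemigroup.mul_mem_kCR_one_left hp q,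
    PartialSemigroup.mul_mem_kCR_one_right hp q⟩⟩
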